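/- Let $(\mathcal C,\mathbb E,\mathfrak s)$ be an extriangulated category (in the sense of Nakaoka and Palu) with enough projectives and enough injectives. "Subcategory" means full additive subcategory closed under isomorphisms and direct summands. The higher extension groups are $\mathbb E^{i+1}(X,Y)=\mathbb E(\Omega^iX,Y)$ for $i\ge 0$, where $\Omega^i X$ is an $i$-th syzygy of $X$, and for a subcategory $\mathcal X$ we put $\mathcal X^{\perp}=\{Y\in\mathcal C : \mathbb E^i(X,Y)=0 \text{ for all } i\ge 1 \text{ and all } X\in\mathcal X\}$. A pair $(\mathcal X,\mathcal W)$ of subcategories of $\mathcal C$ is a *left Frobenius pair* if - $\mathcal X$ is closed under extensions and under cocones of deflations (if $A\to B\to C$ is a conflation with $B,C\in\mathcal X$, then $A\in\mathcal X$); - $\mathcal W\subseteq\mathcal X$, and every $X\in\mathcal X$ admits a conflation $X\to W\to X'$ with $W\in\mathcal W$ and $X'\in\mathcal X$; - $\mathcal W\subseteq\mathcal X^{\perp}$. A subcategory is *thick* if, whenever two of the terms $A,B,C$ of an $\mathbb E$-triangle $A\to B\to C\dashrightarrow$ belong to it, so does the third. $\mathrm{Thick}(\mathcal U)$ denotes the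 smallest thick subcategory containing $\mathcal U$; it is an extriangulated category with the structure inherited from $\mathcal C$. A pair $(\mathcal U,\mathcal V)$ of subcategories of $\mathrm{Thick}(\mathcal U)$ is a *cotorsion pair on* $\mathrm{Thick}(\mathcal U)$ if $\mathbb E(U,V)=0$ for all $U\in\mathcal U$, $V\in\mathcal V$, and every $C\in\mathrm{Thick}(\mathcal U)$ admits conflations $V^C\to U^C\to C$ and $C\to V_C\to U_C$ with $U^C,U_C\in\mathcal U$ and $V^C,V_C\in\mathcal V$. For a subcategory $\mathcal W$, let $\widehat{\mathcal W}$ be the class of objects of finite $\mathcal W$-resolution dimension, that is, of all $C$ for which there are $n\ge 0$ and an $\mathbb E$-triangle sequence $W_n\to W_{n-1}\to\cdots\to W_0\to C$ with all $W_i\in\mathcal W$. (This means that there are objects $K_0=C,K_1,\dots,K_n=W_n$ and conflations $K_{i+1}\to W_i\to K_i$ for $0\le i<n$, the maps of the sequence being the composites $W_{i+1}\to K_{i+1}\to W_i$; for $n=0$ it means $C\in\mathcal W$.) **Theorem.** The assignments $$(\mathcal X,\mathcal W)\mapsto(\mathcal X,\widehat{\mathcal W})\qquad\text{and}\qquad(\mathcal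 U,\mathcal V)\mapsto(\mathcal U,\mathcal U\cap\mathcal V)$$ give mutually inverse bijections between the class of left Frobenius pairs $(\mathcal X,\mathcal W)$ in $\mathcal C$ and the class of cotorsion pairs $(\mathcal U,\mathcal V)$ on the extriangulated category $\mathrm{Thick}(\mathcal U)$ with $\mathcal V\subseteq\mathcal U^{\perp}$. -/

import Mathlib

open CategoryTheory CategoryTheory.Limits Opposite

namespace Extri

universe w v u

section Extensions

variable {C : Type u} [Category.{v} C] [Preadditive C] [HasBinaryBiproducts C]

/-- The group `𝔼(X, A)` of `𝔼`-extensions, contravariant in `X` and covariant in `A`. -/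
abbrev Ext (E : Cᵒᵖ ⥤ C ⥤ AddCommGrpCat.{w}) (X A : C) : Type w :=
  (E.obj (op X)).obj A

/-- The extension `a_* δ`. -/
def push (E : Cᵒᵖ ⥤ C ⥤ AddCommGrpCat.{w}) {X A A' : C} (a : A ⟶ A')
    (δ : Ext E X A) : Ext E X A' :=
  ((E.obj (op X)).map a).hom δ

/-- The extension `c^* δ`. -/
def pull (E : Cᵒᵖ ⥤ C ⥤ AddCommGrpCat.{w}) {X X' A : C} (c : X' ⟶ X)
    (δ : Ext E X A) : Ext E X' A :=
  ((E.map c.op).app A).hom δ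

/-- The extension `δ ⊕ δ'`, i.e. the element of `𝔼(X ⊞ X', A ⊞ A')` with components
`(δ, 0, 0, δ')`. -/
noncomputable def extSum (E : Cᵒᵖ ⥤ C ⥤ AddCommGrpCat.{w}) {X X' A A' : C}
    (δ : Ext E X A) (δ' : Ext E X' A') : Ext E (X ⊞ X') (A ⊞ A') :=
  push E biprod.inl (pull E biprod.fst δ) + push E biprod.inr (pull E biprod.snd δ')

end Extensions

section Sequences

variable {C : Type u} [Category.{v} C]

/-- Sequences `A ⟶ B ⟶ X` with prescribed ends. -/
structure Seq (A X : C) where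
  mid : C
  left : A ⟶ mid
  right : mid ⟶ X

/-- Two sequences with the same ends are equivalent if there is an isomorphism between the
middle terms which is compatible with the maps from `A` and to `X`. -/
def Seq.Equivalent {A X : C} (S S' : Seq A X) : Prop :=
  ∃ b : S.mid ≅ S'.mid, S.left ≫ b.hom = S'.left ∧ b.hom ≫ S'.right = S.right

instance seqSetoid (A X : C) : Setoid (Seq A X) where
  r := Seq.Equivalent
  iseqv :=
    { refl := fun S => ⟨Iso.refl _, by simp, by simp⟩
      symm := by
        rintro S S' ⟨b, h₁, h₂⟩
        exact ⟨b.symm, by simp [← h₁], by simp [← h₂]⟩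
      trans := by
        rintro S S' S'' ⟨b, h₁, h₂⟩ ⟨b', h₁', h₂'⟩
        exact ⟨b ≪≫ b', by simp [← h₁', ← h₁], by simp [← h₂, ← h₂']⟩ }

end Sequences

/-- An additive bifunctor `𝔼 : Cᵒᵖ × C → Ab` together with a correspondence `𝔰` which associates
to every extension in `𝔼(X, A)` an equivalence class of sequences `A ⟶ B ⟶ X`. -/
structure ExtData (C : Type u) [Category.{v} C] [Preadditive C] [HasBinaryBiproducts C] where
  E : Cᵒᵖ ⥤ C ⥤ AddCommGrpCat.{w}
  additive_right : ∀ X : Cᵒᵖ, (E.obj X).Additive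
  additive_left : ∀ A : C, (E.flip.obj A).Additive
  s : ∀ {X A : C}, Ext E X A → Quotient (seqSetoid A X)

/-- The extension `δ` is realized by `A ⟶ B ⟶ X`; in other words, `A ⟶ B ⟶ X` together with `δ`
is an `𝔼`-triangle. -/
def ExtData.Realizes {C : Type u} [Category.{v} C] [Preadditive C] [HasBinaryBiproducts C]
    (T : ExtData.{w} C) {A B X : C} (δ : Ext T.E X A) (x : A ⟶ B) (y : B ⟶ X) : Prop :=
  T.s δ = Quotient.mk (seqSetoid A X) ⟨B, x, y⟩

/-- An extriangulated structure (Nakaoka-Palu) on the additive category `C`. -/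
structure Extriangulated (C : Type u) [Category.{v} C] [Preadditive C] [HasZeroObject C]
    [HasBinaryBiproducts C] extends ExtData.{w} C where
  /-- `𝔰` is a realization: morphisms of extensions are realized. -/
  realization : ∀ {A B X A' B' X' : C} {δ : Ext E X A} {δ' : Ext E X' A'}
    {x : A ⟶ B} {y : B ⟶ X} {x' : A' ⟶ B'} {y' : B' ⟶ X'},
    toExtData.Realizes δ x y → toExtData.Realizes δ' x' y' →
    ∀ (a : A ⟶ A') (c : X ⟶ X'), push E a δ = pull E c δ' →
      ∃ b : B ⟶ B', x ≫ b = a ≫ x' ∧ y ≫ c = b ≫ y'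
  /-- `𝔰` is additive, first half: the zero extension is realized by the split sequence. -/
  realizes_zero : ∀ A X : C,
    toExtData.Realizes (0 : Ext E X A) (biprod.inl : A ⟶ A ⊞ X) biprod.snd
  /-- `𝔰` is additive, second half. -/
  realizes_sum : ∀ {A B X A' B' X' : C} {δ : Ext E X A} {δ' : Ext E X' A'}
    {x : A ⟶ B} {y : B ⟶ X} {x' : A' ⟶ B'} {y' : B' ⟶ X'},
    toExtData.Realizes δ x y → toExtData.Realizes δ' x' y' →
    toExtData.Realizes (extSum E δ δ') (biprod.map x x') (biprod.map y y')
  /-- Axiom (ET3). -/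
  et3 : ∀ {A B X A' B' X' : C} {δ : Ext E X A} {δ' : Ext E X' A'}
    {x : A ⟶ B} {y : B ⟶ X} {x' : A' ⟶ B'} {y' : B' ⟶ X'},
    toExtData.Realizes δ x y → toExtData.Realizes δ' x' y' →
    ∀ (a : A ⟶ A') (b : B ⟶ B'), x ≫ b = a ≫ x' →
      ∃ c : X ⟶ X', push E a δ = pull E c δ' ∧ y ≫ c = b ≫ y'
  /-- Axiom (ET3)ᵒᵖ. -/
  et3_op : ∀ {A B X A' B' X' : C} {δ : Ext E X A} {δ' : Ext E X' A'}
    {x : A ⟶ B} {y : B ⟶ X} {x' : A' ⟶ B'} {y' : B' ⟶ X'},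
    toExtData.Realizes δ x y → toExtData.Realizes δ' x' y' →
    ∀ (b : B ⟶ B') (c : X ⟶ X'), y ≫ c = b ≫ y' →
      ∃ a : A ⟶ A', push E a δ = pull E c δ' ∧ x ≫ b = a ≫ x'
  /-- Axiom (ET4). -/
  et4 : ∀ {A B Z D F : C} {δ : Ext E D A} {δ' : Ext E F B}
    {f : A ⟶ B} {f' : B ⟶ D} {g : B ⟶ Z} {g' : Z ⟶ F},
    toExtData.Realizes δ f f' → toExtData.Realizes δ' g g' →
    ∃ (M : C) (d : D ⟶ M) (e : M ⟶ F) (h : A ⟶ Z) (h' : Z ⟶ M) (δ'' : Ext E M A),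
      f ≫ g = h ∧ f' ≫ d = g ≫ h' ∧ h' ≫ e = g' ∧
      toExtData.Realizes δ'' h h' ∧
      toExtData.Realizes (push E f' δ') d e ∧
      pull E d δ'' = δ ∧
      push E f δ'' = pull E e δ'
  /-- Axiom (ET4)ᵒᵖ. -/
  et4_op : ∀ {A B Z D F : C} {δ : Ext E B D} {δ' : Ext E Z F}
    {f' : D ⟶ A} {f : A ⟶ B} {g' : F ⟶ B} {g : B ⟶ Z},
    toExtData.Realizes δ f' f → toExtData.Realizes δ' g' g →
    ∃ (M : C) (d : D ⟶ M) (e : M ⟶ F) (h' : M ⟶ A) (h : A ⟶ Z) (δ'' : Ext E Z M),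
      f ≫ g = h ∧ d ≫ h' = f' ∧ h' ≫ f = e ≫ g' ∧
      toExtData.Realizes δ'' h' h ∧
      toExtData.Realizes (pull E g' δ) d e ∧
      push E e δ'' = δ' ∧
      push E d δ = pull E g δ''

namespace Extriangulated

variable {C : Type u} [Category.{v} C] [Preadditive C] [HasZeroObject C]
  [HasBinaryBiproducts C] (T : Extriangulated.{w} C)

/-- Conflations: sequences which realize some extension. -/
def IsConflation {A B X : C} (x : A ⟶ B) (y : B ⟶ X) : Prop :=
  ∃ δ : Ext T.E X A, T.Realizes δ x y

/-- Projective objects (relative to the extriangulated structure). -/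
def IsProjective (P : C) : Prop :=
  ∀ {A B X : C} (x : A ⟶ B) (y : B ⟶ X), T.IsConflation x y →
    ∀ c : P ⟶ X, ∃ b : P ⟶ B, b ≫ y = c

/-- Injective objects (relative to the extriangulated structure). -/
def IsInjective (I : C) : Prop :=
  ∀ {A B X : C} (x : A ⟶ B) (y : B ⟶ X), T.IsConflation x y →
    ∀ a : A ⟶ I, ∃ b : B ⟶ I, x ≫ b = a

def EnoughProjectives : Prop :=
  ∀ X : C, ∃ (K P : C) (x : K ⟶ P) (y : P ⟶ X), T.IsConflation x y ∧ T.IsProjective P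

def EnoughInjectives : Prop :=
  ∀ A : C, ∃ (I L : C) (x : A ⟶ I) (y : I ⟶ L), T.IsConflation x y ∧ T.IsInjective I

variable {T} in
/-- A (chosen) syzygy `Ω X` of `X`. -/
noncomputable def syzygy (hP : T.EnoughProjectives) (X : C) : C :=
  (hP X).choose

variable {T} in
/-- The iterated syzygy `Ωⁱ X`. -/
noncomputable def syzygyIter (hP : T.EnoughProjectives) : ℕ → C → C
  | 0, X => X
  | i + 1, X => syzygy hP (syzygyIter hP i X)

variable {T} in
/-- The higher extension group `𝔼ⁱ⁺¹(X, Y) = 𝔼(Ωⁱ X, Y)`, for `i ≥ 0`. Up to isomorphism it does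
not depend on the choice of syzygies. -/
abbrev extSucc (hP : T.EnoughProjectives) (i : ℕ) (X Y : C) : Type w :=
  Ext T.E (syzygyIter hP i X) Y

variable {T} in
/-- The class `𝒳^⊥` of all `Y` with `𝔼ⁱ(X, Y) = 0` for all `i ≥ 1` and all `X` in `𝒳`. -/
def perp (hP : T.EnoughProjectives) (𝒳 : ObjectProperty C) : ObjectProperty C :=
  fun Y => ∀ (i : ℕ) (X : C), 𝒳 X → ∀ ε : extSucc hP i X Y, ε = 0

/-- Closed under extensions: if the outer terms of an `𝔼`-triangle are in `𝒳`, so is the middle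
one. -/
def ClosedUnderExtensions (𝒳 : ObjectProperty C) : Prop :=
  ∀ {A B X : C} (x : A ⟶ B) (y : B ⟶ X), T.IsConflation x y → 𝒳 A → 𝒳 X → 𝒳 B

/-- Closed under cocones of deflations (between objects of `𝒳`). -/
def ClosedUnderCocones (𝒳 : ObjectProperty C) : Prop :=
  ∀ {A B X : C} (x : A ⟶ B) (y : B ⟶ X), T.IsConflation x y → 𝒳 B → 𝒳 X → 𝒳 A

/-- Closed under cones of inflations (between objects of `𝒳`). -/
def ClosedUnderCones (𝒳 : ObjectProperty C) : Prop :=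
  ∀ {A B X : C} (x : A ⟶ B) (y : B ⟶ X), T.IsConflation x y → 𝒳 A → 𝒳 B → 𝒳 X

end Extriangulated

/-- Subcategories: (the object classes of) full additive subcategories which are closed under
isomorphisms and direct summands. -/
structure IsSubcategory {C : Type u} [Category.{v} C] [Preadditive C] [HasBinaryBiproducts C]
    (𝒳 : ObjectProperty C) : Prop where
  iso : ∀ {A B : C}, (A ≅ B) → 𝒳 A → 𝒳 B
  zero : ∀ {A : C}, IsZero A → 𝒳 A
  sum : ∀ {A B : C}, 𝒳 A → 𝒳 B → 𝒳 (A ⊞ B)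
  summand : ∀ {A B : C}, 𝒳 (A ⊞ B) → 𝒳 A

namespace Extriangulated

variable {C : Type u} [Category.{v} C] [Preadditive C] [HasZeroObject C]
  [HasBinaryBiproducts C] (T : Extriangulated.{w} C)

/-- Thick subcategories: if two terms of an `𝔼`-triangle belong to it, so does the third. -/
structure IsThick (𝒳 : ObjectProperty C) : Prop where
  isSubcategory : IsSubcategory 𝒳
  extensions : T.ClosedUnderExtensions 𝒳
  cocones : T.ClosedUnderCocones 𝒳
  cones : T.ClosedUnderCones 𝒳

/-- `Thick(𝒳)`, the smallest thick subcategory containing `𝒳`: the intersection of all of them. -/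
def thick (𝒳 : ObjectProperty C) : ObjectProperty C :=
  fun A => ∀ 𝒴 : ObjectProperty C, T.IsThick 𝒴 → 𝒳 ≤ 𝒴 → 𝒴 A

/-- The class of objects `Z` which admit an `𝔼`-triangle sequence `Xₙ ⟶ ⋯ ⟶ X₀ ⟶ Z` with all
`Xᵢ` in `𝒳`, i.e. objects of `𝒳`-resolution dimension at most `n`. -/
def resDimLE (𝒳 : ObjectProperty C) : ℕ → ObjectProperty C
  | 0 => 𝒳
  | n + 1 => fun Z => ∃ (K X : C) (x : K ⟶ X) (y : X ⟶ Z),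
      T.IsConflation x y ∧ 𝒳 X ∧ resDimLE 𝒳 n K

/-- The class of objects of finite `𝒳`-resolution dimension. -/
def hat (𝒳 : ObjectProperty C) : ObjectProperty C :=
  fun Z => ∃ n, T.resDimLE 𝒳 n Z

/-- `𝒲` is a cogenerator for `𝒳`. -/
def IsCogenerator (𝒳 𝒲 : ObjectProperty C) : Prop :=
  𝒲 ≤ 𝒳 ∧ ∀ X : C, 𝒳 X → ∃ (W X' : C) (x : X ⟶ W) (y : W ⟶ X'),
    T.IsConflation x y ∧ 𝒲 W ∧ 𝒳 X'

variable {T} in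
/-- Left Frobenius pairs `(𝒳, 𝒲)` of subcategories. -/
structure IsLeftFrobeniusPair (hP : T.EnoughProjectives) (𝒳 𝒲 : ObjectProperty C) : Prop where
  isSubcategory_left : IsSubcategory 𝒳
  isSubcategory_right : IsSubcategory 𝒲
  extensions : T.ClosedUnderExtensions 𝒳
  cocones : T.ClosedUnderCocones 𝒳
  cogenerator : T.IsCogenerator 𝒳 𝒲
  relInjective : 𝒲 ≤ perp hP 𝒳

/-- `(𝒰, 𝒱)` is a cotorsion pair on the extriangulated category given by the extension closed
full subcategory `𝒯`. Its extriangulated structure is the restriction of the one on `C`: the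
extension groups of objects of `𝒯` are those in `C`, and its conflations are the conflations of
`C` all of whose terms are in `𝒯`. For `𝒯 = ⊤` this is a cotorsion pair on `C`. -/
structure IsCotorsionPairOn (𝒯 𝒰 𝒱 : ObjectProperty C) : Prop where
  left_le : 𝒰 ≤ 𝒯
  right_le : 𝒱 ≤ 𝒯
  isSubcategory_left : IsSubcategory 𝒰
  isSubcategory_right : IsSubcategory 𝒱
  ext_eq_zero : ∀ U V : C, 𝒰 U → 𝒱 V → ∀ δ : Ext T.E U V, δ = 0
  left_approx : ∀ Z : C, 𝒯 Z → ∃ (V U : C) (x : V ⟶ U) (y : U ⟶ Z),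
    T.IsConflation x y ∧ 𝒰 U ∧ 𝒱 V
  right_approx : ∀ Z : C, 𝒯 Z → ∃ (V U : C) (x : Z ⟶ V) (y : V ⟶ U),
    T.IsConflation x y ∧ 𝒰 U ∧ 𝒱 V

variable {T} in
/-- The class of all left Frobenius pairs. -/
def leftFrobeniusPairs (hP : T.EnoughProjectives) :
    Set (ObjectProperty C × ObjectProperty C) :=
  {p | IsLeftFrobeniusPair hP p.1 p.2}

variable {T} in
/-- The class of all cotorsion pairs `(𝒰, 𝒱)` on `Thick(𝒰)` with `𝒱 ⊆ 𝒰^⊥`. -/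
def thickCotorsionPairs (hP : T.EnoughProjectives) :
    Set (ObjectProperty C × ObjectProperty C) :=
  {p | T.IsCotorsionPairOn (T.thick p.1) p.1 p.2 ∧ p.2 ≤ perp hP p.1}

end Extriangulated

end Extri

/-! The core is Auslander–Buchweitz approximation. For a left Frobenius pair, dimension shifting
gives `hat 𝒲 ≤ perp hP 𝒳` (`perp_hat`), and induction on resolution dimension embeds each object of
`hat 𝒳` in an object of `hat 𝒲` with cone in `𝒳` (`approximations`); stopping the construction one
step earlier gives the approximation from the left. Together with the splittings forced by vanishing
of `𝔼(𝒳, hat 𝒲)`, these approximations show that `hat 𝒳` is thick (`hat_isThick`). Hence it equals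
`thick 𝒳`, and the two approximations are exactly those of a cotorsion pair.

Conversely, both halves of a cotorsion pair on `𝒯` are orthogonal classes inside `𝒯` (`left_iff`,
`right_iff`). This gives extension closure of `𝒰`; vanishing of `𝔼²(𝒰, 𝒱)` gives closure under
cocones.

The assignments are inverse because `𝒲` is recovered as `𝒳 ⊓ hat 𝒲` (`inf_hat`), and `hat 𝒲` is the
right orthogonal of `𝒳` in `hat 𝒳` (`hat_right_iff`), which determines `𝒱`. -/

namespace Extri

namespace Extriangulated

/-! ### Functoriality and biadditivity of `𝔼`. -/

section Bifunctor

variable {C : Type u} [Category.{v} C] [Preadditive C] [HasZeroObject C]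
  [HasBinaryBiproducts C] (T : Extriangulated.{w} C)

lemma push_id {X A : C} (δ : Ext T.E X A) : push T.E (𝟙 A) δ = δ := by
  simp [push]

lemma push_comp {X A A' A'' : C} (a : A ⟶ A') (b : A' ⟶ A'') (δ : Ext T.E X A) :
    push T.E (a ≫ b) δ = push T.E b (push T.E a δ) := by
  simp [push]

lemma pull_id {X A : C} (δ : Ext T.E X A) : pull T.E (𝟙 X) δ = δ := by
  simp [pull]

lemma pull_comp {X X' X'' A : C} (c : X'' ⟶ X') (d : X' ⟶ X) (δ : Ext T.E X A) :
    pull T.E (c ≫ d) δ = pull T.E c (pull T.E d δ) := by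
  simp [pull]

lemma push_add {X A A' : C} (a : A ⟶ A') (δ ε : Ext T.E X A) :
    push T.E a (δ + ε) = push T.E a δ + push T.E a ε := by
  simp [push]

lemma pull_add {X X' A : C} (c : X' ⟶ X) (δ ε : Ext T.E X A) :
    pull T.E c (δ + ε) = pull T.E c δ + pull T.E c ε := by
  simp [pull]

lemma push_zero {X A A' : C} (a : A ⟶ A') : push T.E a (0 : Ext T.E X A) = 0 := by
  simp [push]

lemma pull_zero {X X' A : C} (c : X' ⟶ X) : pull T.E c (0 : Ext T.E X A) = 0 := by
  simp [pull]

lemma zero_push {X A A' : C} (δ : Ext T.E X A) : push T.E (0 : A ⟶ A') δ = 0 := by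
  have := T.additive_right (op X)
  simp [push]

lemma zero_pull {X X' A : C} (δ : Ext T.E X A) : pull T.E (0 : X' ⟶ X) δ = 0 := by
  have := T.additive_left A
  have h : (T.E.flip.obj A).map (0 : op X ⟶ op X') = 0 := Functor.map_zero _ _ _
  exact congrArg (fun f => f.hom δ) h

lemma push_pull {X X' A A' : C} (a : A ⟶ A') (c : X' ⟶ X) (δ : Ext T.E X A) :
    push T.E a (pull T.E c δ) = pull T.E c (push T.E a δ) := by
  have h := congrArg (fun f => f.hom δ) ((T.E.map c.op).naturality a)
  exact h.symm

end Bifunctor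

/-! ### Realizations and their invariance under isomorphism of the end terms. -/

section Realizations

variable {C : Type u} [Category.{v} C] [Preadditive C] [HasZeroObject C]
  [HasBinaryBiproducts C] {T : Extriangulated.{w} C}

lemma exists_realizes {X A : C} (δ : Ext T.E X A) :
    ∃ (B : C) (x : A ⟶ B) (y : B ⟶ X), T.Realizes δ x y := by
  obtain ⟨⟨B, x, y⟩, h⟩ := Quotient.exists_rep (T.s δ)
  exact ⟨B, x, y, h.symm⟩

lemma realizes_iso_mid {X A B B' : C} {δ : Ext T.E X A} {x : A ⟶ B} {y : B ⟶ X}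
    (h : T.Realizes δ x y) (i : B ≅ B') : T.Realizes δ (x ≫ i.hom) (i.inv ≫ y) := by
  refine Eq.trans h (Quotient.sound ?_)
  exact ⟨i, rfl, by simp⟩

lemma realizes_unique {X A B B' : C} {δ : Ext T.E X A} {x : A ⟶ B} {y : B ⟶ X}
    {x' : A ⟶ B'} {y' : B' ⟶ X} (h : T.Realizes δ x y) (h' : T.Realizes δ x' y') :
    ∃ b : B ≅ B', x ≫ b.hom = x' ∧ b.hom ≫ y' = y :=
  Quotient.exact (Eq.trans (Eq.symm h) h')

lemma realizes_id {Z O : C} (hO : IsZero O) :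
    T.Realizes (0 : Ext T.E Z O) (0 : O ⟶ Z) (𝟙 Z) := by
  have h := T.realizes_zero O Z
  let i : O ⊞ Z ≅ Z :=
    { hom := biprod.snd
      inv := biprod.inr
      hom_inv_id := by
        apply biprod.hom_ext'
        · exact hO.eq_of_src _ _
        · simp
      inv_hom_id := by simp }
  have h' := realizes_iso_mid h i
  simpa [i] using h'

/-- The map to the third term of an `𝔼`-triangle is a weak cokernel. -/
lemma exists_desc {X A B Z : C} {δ : Ext T.E X A} {x : A ⟶ B} {y : B ⟶ X}
    (h : T.Realizes δ x y) (n : B ⟶ Z) (hn : x ≫ n = 0) : ∃ m : X ⟶ Z, y ≫ m = n := by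
  -- The comparison is with the triangle `0 ⟶ Z ⟶ Z`, whose deflation is the identity.
  obtain ⟨c, -, hc⟩ := T.et3 h (realizes_id (Z := Z) (isZero_zero C)) 0 n (by simp [hn])
  exact ⟨c, by simpa using hc⟩

/-- Since `e - 𝟙` kills `x`, it factors through `y`; since it is also killed by `y`, it squares to
zero. So `2 - e` is inverse to `e`. This stands in for the five lemma. -/
lemma isIso_of_endomorphism {X A B : C} {δ : Ext T.E X A} {x : A ⟶ B} {y : B ⟶ X}
    (h : T.Realizes δ x y) (e : B ⟶ B) (h₁ : x ≫ e = x) (h₂ : e ≫ y = y) : IsIso e := by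
  obtain ⟨m, hm⟩ := exists_desc h (e - 𝟙 B) (by simp [h₁])
  have hn : (e - 𝟙 B) ≫ (e - 𝟙 B) = 0 := by
    nth_rw 2 [← hm]
    rw [← Category.assoc]
    simp [h₂]
  have hee : e ≫ e = e + e - 𝟙 B := by
    simp only [Preadditive.sub_comp, Preadditive.comp_sub, Category.id_comp,
      Category.comp_id] at hn
    have : e ≫ e = (e ≫ e - e - (e - 𝟙 B)) + (e + e - 𝟙 B) := by abel
    rw [this, hn, zero_add]
  exact ⟨𝟙 B + 𝟙 B - e, by simp [hee], by simp [hee]⟩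

/-- The transported extension has some realization; comparison maps in both directions have
invertible composites by `isIso_of_endomorphism`, so its middle term can be replaced by `B`. -/
lemma isConflation_of_iso {X X' A A' B : C} {x : A ⟶ B} {y : B ⟶ X}
    (h : T.IsConflation x y) (a : A ≅ A') (c : X ≅ X') :
    T.IsConflation (a.inv ≫ x) (y ≫ c.hom) := by
  obtain ⟨δ, h⟩ := h
  let δ' : Ext T.E X' A' := push T.E a.hom (pull T.E c.inv δ)
  obtain ⟨B', x', y', h'⟩ := exists_realizes δ'
  obtain ⟨b, hb₁, hb₂⟩ := T.realization h h' a.hom c.hom (by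
    rw [← push_pull, ← pull_comp]; simp [pull_id])
  obtain ⟨b', hb₁', hb₂'⟩ := T.realization h' h a.inv c.inv (by
    rw [← push_comp]; simp [push_id])
  have i₁ : IsIso (b ≫ b') := isIso_of_endomorphism h _
    (by rw [reassoc_of% hb₁, hb₁', Iso.hom_inv_id_assoc])
    (by rw [Category.assoc, ← hb₂', ← reassoc_of% hb₂, Iso.hom_inv_id, Category.comp_id])
  have i₂ : IsIso (b' ≫ b) := isIso_of_endomorphism h' _
    (by rw [reassoc_of% hb₁', hb₁, Iso.inv_hom_id_assoc])
    (by rw [Category.assoc, ← hb₂, ← reassoc_of% hb₂', Iso.inv_hom_id, Category.comp_id])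
  have hb' : IsIso b' := by
    have hs : IsSplitEpi b' := ⟨⟨inv (b ≫ b') ≫ b, by simp⟩⟩
    have hm : IsSplitMono b' := ⟨⟨b ≫ inv (b' ≫ b), by
      rw [← Category.assoc, IsIso.hom_inv_id]⟩⟩
    exact isIso_of_epi_of_isSplitMono b'
  refine ⟨δ', ?_⟩
  have h₃ := realizes_iso_mid h' (asIso b')
  have e₁ : x' ≫ (asIso b').hom = a.inv ≫ x := hb₁'
  have e₂ : (asIso b').inv ≫ y' = y ≫ c.hom := by
    rw [Iso.inv_comp_eq, asIso_hom, ← Category.assoc, ← hb₂']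
    simp
  rwa [e₁, e₂] at h₃

end Realizations

/-! ### Octahedra, pullbacks, pushouts and vanishing of extensions. -/

section Triangles

variable {C : Type u} [Category.{v} C] [Preadditive C] [HasZeroObject C]
  [HasBinaryBiproducts C] (T : Extriangulated.{w} C)

/-- There is a conflation `A ⟶ B ⟶ X`. -/
def HasConflation (A B X : C) : Prop :=
  ∃ (x : A ⟶ B) (y : B ⟶ X), T.IsConflation x y

/-- `𝔼(X, A) = 0`. -/
def Vanishes (X A : C) : Prop :=
  ∀ δ : Ext T.E X A, δ = 0

variable {T}

lemma HasConflation.of_iso {A B X A' B' X' : C} (h : T.HasConflation A B X)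
    (a : A ≅ A') (b : B ≅ B') (c : X ≅ X') : T.HasConflation A' B' X' := by
  obtain ⟨x, y, h⟩ := h
  obtain ⟨δ, h⟩ := isConflation_of_iso h a c
  exact ⟨_, _, δ, realizes_iso_mid h b⟩

lemma hasConflation_biprod (A X : C) : T.HasConflation A (A ⊞ X) X :=
  ⟨_, _, _, T.realizes_zero A X⟩

lemma realizes_inr_fst (A X : C) :
    T.Realizes (0 : Ext T.E A X) (biprod.inr : X ⟶ A ⊞ X) biprod.fst := by
  have h := realizes_iso_mid (T.realizes_zero X A) (biprod.braiding X A)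
  have e₁ : (biprod.inl : X ⟶ X ⊞ A) ≫ (biprod.braiding X A).hom = biprod.inr := by
    ext <;> simp
  have e₂ : (biprod.braiding X A).inv ≫ (biprod.snd : X ⊞ A ⟶ A) = biprod.fst := by
    ext <;> simp
  rwa [e₁, e₂] at h

lemma hasConflation_biprod' (A X : C) : T.HasConflation X (A ⊞ X) A :=
  ⟨_, _, _, realizes_inr_fst A X⟩

lemma hasConflation_id {O : C} (hO : IsZero O) (Z : C) : T.HasConflation O Z Z :=
  ⟨_, _, _, realizes_id hO⟩

lemma HasConflation.sum {A B X A' B' X' : C} (h : T.HasConflation A B X)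
    (h' : T.HasConflation A' B' X') : T.HasConflation (A ⊞ A') (B ⊞ B') (X ⊞ X') := by
  obtain ⟨x, y, δ, h⟩ := h
  obtain ⟨x', y', δ', h'⟩ := h'
  exact ⟨_, _, _, T.realizes_sum h h'⟩

lemma HasConflation.octahedron {A B Z D F : C} (h : T.HasConflation A B D)
    (h' : T.HasConflation B Z F) :
    ∃ M, T.HasConflation A Z M ∧ T.HasConflation D M F := by
  obtain ⟨f, f', δ, h⟩ := h
  obtain ⟨g, g', δ', h'⟩ := h'
  obtain ⟨M, d, e, k, k', δ'', -, -, -, h₁, h₂, -⟩ := T.et4 h h'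
  exact ⟨M, ⟨_, _, _, h₁⟩, ⟨_, _, _, h₂⟩⟩

lemma HasConflation.octahedron_op {A B Z D F : C} (h : T.HasConflation D A B)
    (h' : T.HasConflation F B Z) :
    ∃ M, T.HasConflation M A Z ∧ T.HasConflation D M F := by
  obtain ⟨f, f', δ, h⟩ := h
  obtain ⟨g, g', δ', h'⟩ := h'
  obtain ⟨M, d, e, k, k', δ'', -, -, -, h₁, h₂, -⟩ := T.et4_op h h'
  exact ⟨M, ⟨_, _, _, h₁⟩, ⟨_, _, _, h₂⟩⟩

/-- Two deflations with the same target have a common pullback. -/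
lemma HasConflation.pullback {A₁ B₁ A₂ B₂ X : C} (h₁ : T.HasConflation A₁ B₁ X)
    (h₂ : T.HasConflation A₂ B₂ X) :
    ∃ M, T.HasConflation A₁ M B₂ ∧ T.HasConflation A₂ M B₁ := by
  obtain ⟨x₁, y₁, δ₁, h₁⟩ := h₁
  obtain ⟨x₂, y₂, δ₂, h₂⟩ := h₂
  -- The pullback is the middle term of the extension with components `δ₁` and `δ₂`. (ET4) along
  -- each summand inclusion of `A₁ ⊞ A₂` leaves a quotient realizing the other component, hence
  -- isomorphic to `B₂` or `B₁`.
  let μ : Ext T.E X (A₁ ⊞ A₂) := push T.E biprod.inl δ₁ + push T.E biprod.inr δ₂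
  have hμ₁ : push T.E biprod.fst μ = δ₁ := by
    rw [push_add, ← push_comp, ← push_comp]
    simp [push_id, zero_push]
  have hμ₂ : push T.E biprod.snd μ = δ₂ := by
    rw [push_add, ← push_comp, ← push_comp]
    simp [push_id, zero_push]
  obtain ⟨M, x, y, h⟩ := exists_realizes μ
  obtain ⟨M₂, d, e, k, k', δ'', -, -, -, h₃, h₄, -⟩ := T.et4 (T.realizes_zero A₁ A₂) h
  obtain ⟨M₁, d', e', l, l', ε'', -, -, -, h₅, h₆, -⟩ := T.et4 (realizes_inr_fst A₁ A₂) h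
  rw [hμ₂] at h₄
  rw [hμ₁] at h₆
  obtain ⟨i₂, -⟩ := realizes_unique h₄ h₂
  obtain ⟨i₁, -⟩ := realizes_unique h₆ h₁
  exact ⟨M, HasConflation.of_iso ⟨_, _, _, h₃⟩ (Iso.refl _) (Iso.refl _) i₂,
    HasConflation.of_iso ⟨_, _, _, h₅⟩ (Iso.refl _) (Iso.refl _) i₁⟩

/-- Two inflations with the same source have a common pushout. -/
lemma HasConflation.pushout {A B₁ X₁ B₂ X₂ : C} (h₁ : T.HasConflation A B₁ X₁)
    (h₂ : T.HasConflation A B₂ X₂) :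
    ∃ M, T.HasConflation B₁ M X₂ ∧ T.HasConflation B₂ M X₁ := by
  obtain ⟨x₁, y₁, δ₁, h₁⟩ := h₁
  obtain ⟨x₂, y₂, δ₂, h₂⟩ := h₂
  let μ : Ext T.E (X₁ ⊞ X₂) A := pull T.E biprod.fst δ₁ + pull T.E biprod.snd δ₂
  have hμ₁ : pull T.E biprod.inl μ = δ₁ := by
    rw [pull_add, ← pull_comp, ← pull_comp]
    simp [pull_id, zero_pull]
  have hμ₂ : pull T.E biprod.inr μ = δ₂ := by
    rw [pull_add, ← pull_comp, ← pull_comp]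
    simp [pull_id, zero_pull]
  obtain ⟨M, x, y, h⟩ := exists_realizes μ
  obtain ⟨M₁, d, e, k, k', δ'', -, -, -, h₃, h₄, -⟩ := T.et4_op h (T.realizes_zero X₁ X₂)
  obtain ⟨M₂, d', e', l, l', ε'', -, -, -, h₅, h₆, -⟩ := T.et4_op h (realizes_inr_fst X₁ X₂)
  rw [hμ₁] at h₄
  rw [hμ₂] at h₆
  obtain ⟨i₁, -⟩ := realizes_unique h₄ h₁
  obtain ⟨i₂, -⟩ := realizes_unique h₆ h₂
  exact ⟨M, HasConflation.of_iso ⟨_, _, _, h₃⟩ i₁ (Iso.refl _) (Iso.refl _),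
    HasConflation.of_iso ⟨_, _, _, h₅⟩ i₂ (Iso.refl _) (Iso.refl _)⟩

lemma HasConflation.split {A B X : C} (h : T.HasConflation A B X) (hv : T.Vanishes X A) :
    Nonempty (B ≅ A ⊞ X) := by
  obtain ⟨x, y, δ, h⟩ := h
  obtain rfl := hv δ
  obtain ⟨i, -⟩ := realizes_unique h (T.realizes_zero A X)
  exact ⟨i⟩

lemma Vanishes.of_retract_left {X Y A : C} (h : T.Vanishes Y A) (i : X ⟶ Y) (r : Y ⟶ X)
    (hir : i ≫ r = 𝟙 X) : T.Vanishes X A := fun δ => by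
  rw [← T.pull_id δ, ← hir, pull_comp, h (pull T.E r δ), pull_zero]

lemma Vanishes.of_retract_right {X A B : C} (h : T.Vanishes X B) (i : A ⟶ B) (r : B ⟶ A)
    (hir : i ≫ r = 𝟙 A) : T.Vanishes X A := fun δ => by
  rw [← T.push_id δ, ← hir, push_comp, h (push T.E i δ), push_zero]

/-- Exactness of `𝔼(Y, -)` at `B`. As `y_* θ = 0`, the map `e` of the octahedron has a section, and
pulling `e^* θ = x_* δ''` back along it exhibits `θ` as a pushforward from `𝔼(Y, A) = 0`. -/
lemma Vanishes.mid_right {Y A B X : C} (h : T.HasConflation A B X) (hA : T.Vanishes Y A)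
    (hX : T.Vanishes Y X) : T.Vanishes Y B := fun θ => by
  obtain ⟨x, y, δ, h⟩ := h
  obtain ⟨Z, g, g', hθ⟩ := exists_realizes θ
  obtain ⟨M, d, e, k, k', δ'', -, -, -, h₁, h₂, h₃, h₄⟩ := T.et4 h hθ
  rw [hX (push T.E y θ)] at h₂
  obtain ⟨i, -, hi⟩ := realizes_unique h₂ (T.realizes_zero X Y)
  have hs : (biprod.inr ≫ i.inv) ≫ e = 𝟙 Y := by rw [← hi]; simp
  rw [← T.pull_id θ, ← hs, pull_comp, ← h₄, ← push_pull, hA (pull T.E _ δ''), push_zero]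

lemma Vanishes.mid_left {Y A B X : C} (h : T.HasConflation A B X) (hA : T.Vanishes A Y)
    (hX : T.Vanishes X Y) : T.Vanishes B Y := fun θ => by
  obtain ⟨x, y, δ, h⟩ := h
  obtain ⟨Z, g, g', hθ⟩ := exists_realizes θ
  obtain ⟨M, d, e, k, k', δ'', -, -, -, h₁, h₂, h₃, h₄⟩ := T.et4_op hθ h
  rw [hA (pull T.E x θ)] at h₂
  obtain ⟨i, hi, -⟩ := realizes_unique h₂ (T.realizes_zero Y A)
  have hs : d ≫ (i.hom ≫ biprod.fst) = 𝟙 Y := by rw [← Category.assoc, hi]; simp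
  rw [← T.push_id θ, ← hs, push_comp, h₄, push_pull, hX (push T.E _ δ''), pull_zero]

/-- A morphism to the third term of an `𝔼`-triangle lifts if it annihilates the extension. -/
lemma exists_lift {Y A B X : C} {δ : Ext T.E X A} {x : A ⟶ B} {y : B ⟶ X}
    (h : T.Realizes δ x y) (φ : Y ⟶ X) (hφ : pull T.E φ δ = 0) : ∃ ψ : Y ⟶ B, ψ ≫ y = φ := by
  obtain ⟨b, -, hb⟩ := T.realization (T.realizes_zero A Y) h (𝟙 A) φ
    (by rw [hφ, push_zero])
  exact ⟨biprod.inr ≫ b, by rw [Category.assoc, ← hb]; simp⟩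

lemma IsProjective.vanishes {P : C} (hP : T.IsProjective P) (A : C) : T.Vanishes P A :=
  fun δ => by
  obtain ⟨B, x, y, h⟩ := exists_realizes δ
  obtain ⟨s, hs⟩ := hP x y ⟨δ, h⟩ (𝟙 P)
  obtain ⟨a, ha, -⟩ := T.et3_op (T.realizes_zero A P) h (biprod.desc 0 s) (𝟙 P)
    (by ext <;> simp [hs])
  rw [push_zero, pull_id] at ha
  exact ha.symm

/-- Dimension shift: `𝔼(Y, W) = 0` and `𝔼²(Y, K) = 0` imply `𝔼(Y, Z) = 0`. -/
lemma Vanishes.of_syzygy_right {Y S P K W Z : C} (h : T.HasConflation K W Z)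
    (hS : T.HasConflation S P Y) (hP : T.IsProjective P) (hW : T.Vanishes Y W)
    (hK : T.Vanishes S K) : T.Vanishes Y Z := fun ε => by
  obtain ⟨x, y, δ, h⟩ := h
  obtain ⟨s, p, σ, hS⟩ := hS
  obtain ⟨N, q, r, hε⟩ := exists_realizes ε
  obtain ⟨b, hb⟩ := hP q r ⟨ε, hε⟩ p
  -- Projectivity of `P` makes `ε` a pushforward `φ_* σ` of the syzygy extension. The obstruction to
  -- lifting `φ` to `W` lies in `𝔼(S, K) = 0`, so `ε` comes from `𝔼(Y, W) = 0`.
  obtain ⟨φ, hφ, -⟩ := T.et3_op hS hε b (𝟙 Y) (by simp [hb])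
  obtain ⟨ψ, rfl⟩ := exists_lift h φ (hK _)
  rw [← T.pull_id ε, ← hφ, push_comp, hW (push T.E ψ σ), push_zero]

/-- Dimension shift: `𝔼(B, V) = 0` and `𝔼²(X, V) = 0` imply `𝔼(A, V) = 0`. -/
lemma Vanishes.of_syzygy_left {A B X S P V : C} (h : T.HasConflation A B X)
    (hS : T.HasConflation S P X) (hP : T.IsProjective P) (hB : T.Vanishes B V)
    (hV : T.Vanishes S V) : T.Vanishes A V := by
  -- The pullback is an extension of `B` by `S`, so `𝔼(M, V) = 0`; it is also an extension of `P` by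
  -- `A`, which splits, so `A` is a retract of `M`.
  obtain ⟨M, hM₁, hM₂⟩ := h.pullback hS
  obtain ⟨i⟩ := hM₁.split (hP.vanishes A)
  exact (Vanishes.mid_left hM₂ hV hB).of_retract_left (biprod.inl ≫ i.inv)
    (i.hom ≫ biprod.fst) (by simp)

lemma syzygy_hasConflation (hP : T.EnoughProjectives) (X : C) :
    ∃ P, T.HasConflation (syzygy hP X) P X ∧ T.IsProjective P := by
  obtain ⟨P, x, y, h, hp⟩ := (hP X).choose_spec
  exact ⟨P, ⟨x, y, h⟩, hp⟩

/-! ### Resolution dimension and thick closure. -/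

lemma prop_of_extensions {𝒳 : ObjectProperty C} (h : T.ClosedUnderExtensions 𝒳)
    {A B X : C} (hc : T.HasConflation A B X) (hA : 𝒳 A) (hX : 𝒳 X) : 𝒳 B := by
  obtain ⟨x, y, hc⟩ := hc
  exact h x y hc hA hX

lemma prop_of_cocones {𝒳 : ObjectProperty C} (h : T.ClosedUnderCocones 𝒳)
    {A B X : C} (hc : T.HasConflation A B X) (hB : 𝒳 B) (hX : 𝒳 X) : 𝒳 A := by
  obtain ⟨x, y, hc⟩ := hc
  exact h x y hc hB hX

lemma resDimLE_succ_iff {𝒳 : ObjectProperty C} {n : ℕ} {Z : C} :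
    T.resDimLE 𝒳 (n + 1) Z ↔ ∃ K X, T.HasConflation K X Z ∧ 𝒳 X ∧ T.resDimLE 𝒳 n K := by
  constructor
  · rintro ⟨K, X, x, y, h, hX, hK⟩
    exact ⟨K, X, ⟨x, y, h⟩, hX, hK⟩
  · rintro ⟨K, X, ⟨x, y, h⟩, hX, hK⟩
    exact ⟨K, X, x, y, h, hX, hK⟩

lemma resDimLE_mono {𝒳 𝒴 : ObjectProperty C} (h : 𝒳 ≤ 𝒴) (n : ℕ) :
    T.resDimLE 𝒳 n ≤ T.resDimLE 𝒴 n := by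
  induction n with
  | zero => exact h
  | succ n ih =>
    rintro Z ⟨K, X, x, y, hc, hX, hK⟩
    exact ⟨K, X, x, y, hc, h _ hX, ih _ hK⟩

lemma resDimLE_succ {𝒳 : ObjectProperty C} (h𝒳 : IsSubcategory 𝒳) (n : ℕ) :
    T.resDimLE 𝒳 n ≤ T.resDimLE 𝒳 (n + 1) := by
  induction n with
  | zero =>
    exact fun Z hZ => resDimLE_succ_iff.2
      ⟨_, Z, hasConflation_id (isZero_zero C) Z, hZ, h𝒳.zero (isZero_zero C)⟩
  | succ n ih =>
    rintro Z ⟨K, X, x, y, hc, hX, hK⟩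
    exact ⟨K, X, x, y, hc, hX, ih _ hK⟩

lemma resDimLE_le {𝒳 : ObjectProperty C} (h𝒳 : IsSubcategory 𝒳) {m n : ℕ} (h : m ≤ n) :
    T.resDimLE 𝒳 m ≤ T.resDimLE 𝒳 n := by
  induction h with
  | refl => exact le_rfl
  | step _ ih => exact ih.trans (resDimLE_succ h𝒳 _)

lemma resDimLE_iso {𝒳 : ObjectProperty C} (h𝒳 : IsSubcategory 𝒳) {n : ℕ} {Z Z' : C}
    (i : Z ≅ Z') (hZ : T.resDimLE 𝒳 n Z) : T.resDimLE 𝒳 n Z' := by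
  cases n with
  | zero => exact h𝒳.iso i hZ
  | succ n =>
    obtain ⟨K, X, hc, hX, hK⟩ := resDimLE_succ_iff.1 hZ
    exact resDimLE_succ_iff.2 ⟨K, X, hc.of_iso (Iso.refl _) (Iso.refl _) i, hX, hK⟩

lemma resDimLE_sum {𝒳 : ObjectProperty C} (h𝒳 : IsSubcategory 𝒳) {n : ℕ} {Z Z' : C}
    (hZ : T.resDimLE 𝒳 n Z) (hZ' : T.resDimLE 𝒳 n Z') : T.resDimLE 𝒳 n (Z ⊞ Z') := by
  induction n generalizing Z Z' with
  | zero => exact h𝒳.sum hZ hZ'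
  | succ n ih =>
    obtain ⟨K, X, hc, hX, hK⟩ := resDimLE_succ_iff.1 hZ
    obtain ⟨K', X', hc', hX', hK'⟩ := resDimLE_succ_iff.1 hZ'
    exact resDimLE_succ_iff.2 ⟨_, _, hc.sum hc', h𝒳.sum hX hX', ih hK hK'⟩

lemma hat_of_prop {𝒳 : ObjectProperty C} : 𝒳 ≤ T.hat 𝒳 := fun _ h => ⟨0, h⟩

lemma hat_of_hasConflation {𝒳 : ObjectProperty C} {K X Z : C} (h : T.HasConflation K X Z)
    (hX : 𝒳 X) (hK : T.hat 𝒳 K) : T.hat 𝒳 Z := by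
  obtain ⟨n, hK⟩ := hK
  exact ⟨n + 1, resDimLE_succ_iff.2 ⟨K, X, h, hX, hK⟩⟩

lemma exists_of_hat {𝒳 : ObjectProperty C} (h𝒳 : IsSubcategory 𝒳) {Z : C}
    (hZ : T.hat 𝒳 Z) : ∃ K X, T.HasConflation K X Z ∧ 𝒳 X ∧ T.hat 𝒳 K := by
  obtain ⟨n, hZ⟩ := hZ
  obtain ⟨K, X, hc, hX, hK⟩ := resDimLE_succ_iff.1 (resDimLE_succ h𝒳 n _ hZ)
  exact ⟨K, X, hc, hX, n, hK⟩

lemma hat_iso {𝒳 : ObjectProperty C} (h𝒳 : IsSubcategory 𝒳) {Z Z' : C}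
    (i : Z ≅ Z') (hZ : T.hat 𝒳 Z) : T.hat 𝒳 Z' := by
  obtain ⟨n, hZ⟩ := hZ
  exact ⟨n, resDimLE_iso h𝒳 i hZ⟩

lemma hat_sum {𝒳 : ObjectProperty C} (h𝒳 : IsSubcategory 𝒳) {Z Z' : C}
    (hZ : T.hat 𝒳 Z) (hZ' : T.hat 𝒳 Z') : T.hat 𝒳 (Z ⊞ Z') := by
  obtain ⟨n, hZ⟩ := hZ
  obtain ⟨m, hZ'⟩ := hZ'
  exact ⟨max n m, resDimLE_sum h𝒳 (resDimLE_le h𝒳 (le_max_left _ _) _ hZ)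
    (resDimLE_le h𝒳 (le_max_right _ _) _ hZ')⟩

lemma hat_mono {𝒳 𝒴 : ObjectProperty C} (h : 𝒳 ≤ 𝒴) : T.hat 𝒳 ≤ T.hat 𝒴 :=
  fun _ ⟨n, hZ⟩ => ⟨n, resDimLE_mono h n _ hZ⟩

lemma le_thick (𝒳 : ObjectProperty C) : 𝒳 ≤ T.thick 𝒳 := fun A hA _ _ h => h A hA

lemma thick_isThick (𝒳 : ObjectProperty C) : T.IsThick (T.thick 𝒳) where
  isSubcategory :=
    { iso := fun i h 𝒴 hY hle => hY.isSubcategory.iso i (h 𝒴 hY hle)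
      zero := fun h _ hY _ => hY.isSubcategory.zero h
      sum := fun h h' 𝒴 hY hle => hY.isSubcategory.sum (h 𝒴 hY hle) (h' 𝒴 hY hle)
      summand := fun h 𝒴 hY hle => hY.isSubcategory.summand (h 𝒴 hY hle) }
  extensions := fun x y hc h h' 𝒴 hY hle => hY.extensions x y hc (h 𝒴 hY hle) (h' 𝒴 hY hle)
  cocones := fun x y hc h h' 𝒴 hY hle => hY.cocones x y hc (h 𝒴 hY hle) (h' 𝒴 hY hle)
  cones := fun x y hc h h' 𝒴 hY hle => hY.cones x y hc (h 𝒴 hY hle) (h' 𝒴 hY hle)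

lemma hat_le_thick (𝒳 : ObjectProperty C) : T.hat 𝒳 ≤ T.thick 𝒳 := by
  rintro Z ⟨n, hZ⟩
  induction n generalizing Z with
  | zero => exact le_thick 𝒳 _ hZ
  | succ n ih =>
    obtain ⟨K, X, x, y, hc, hX, hK⟩ := hZ
    exact (thick_isThick 𝒳).cones x y hc (ih K hK) (le_thick 𝒳 _ hX)

/-- Composing a deflation `X₀ ⟶ B` from a resolution with `B ⟶ X` gives a cocone that is an
extension of `A` by `K`. -/
lemma hat_cones {𝒳 : ObjectProperty C} (h𝒳 : IsSubcategory 𝒳)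
    (hE : T.ClosedUnderExtensions (T.hat 𝒳)) : T.ClosedUnderCones (T.hat 𝒳) := by
  intro A B X x y hc hA hB
  obtain ⟨K, X₀, hc', hX₀, hK⟩ := exists_of_hat h𝒳 hB
  obtain ⟨M, hM, hM'⟩ := hc'.octahedron_op ⟨x, y, hc⟩
  exact hat_of_hasConflation hM hX₀ (prop_of_extensions hE hM' hK hA)

end Triangles

/-! ### Left Frobenius pairs: approximations and thickness of `hat 𝒳`. -/

section Frobenius

variable {C : Type u} [Category.{v} C] [Preadditive C] [HasZeroObject C]
  [HasBinaryBiproducts C] {T : Extriangulated.{w} C} {hP : T.EnoughProjectives}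
  {𝒳 𝒲 : ObjectProperty C}

lemma perp_hat (h : 𝒲 ≤ perp hP 𝒳) : T.hat 𝒲 ≤ perp hP 𝒳 := by
  rintro Z ⟨n, hZ⟩
  induction n generalizing Z with
  | zero => exact h _ hZ
  | succ n ih =>
    obtain ⟨K, W, hc, hW, hK⟩ := resDimLE_succ_iff.1 hZ
    -- The degree stays universally quantified in the induction: vanishing for `Z` in one degree
    -- uses vanishing for `K` in the next.
    intro i X hX
    obtain ⟨P, hS, hp⟩ := syzygy_hasConflation hP (syzygyIter hP i X)
    exact Vanishes.of_syzygy_right hc hS hp (h _ hW i X hX) (ih K hK (i + 1) X hX)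

namespace IsLeftFrobeniusPair

variable (h : IsLeftFrobeniusPair hP 𝒳 𝒲)
include h

lemma vanishes_hat {X Z : C} (hX : 𝒳 X) (hZ : T.hat 𝒲 Z) : T.Vanishes X Z :=
  perp_hat h.relInjective Z hZ 0 X hX

lemma exists_cogenerator {X : C} (hX : 𝒳 X) :
    ∃ W X', T.HasConflation X W X' ∧ 𝒲 W ∧ 𝒳 X' := by
  obtain ⟨W, X', x, y, hc, hW, hX'⟩ := h.cogenerator.2 X hX
  exact ⟨W, X', ⟨x, y, hc⟩, hW, hX'⟩

/-- Pushing out the first step of a resolution along the approximation of `K` gives `W' ⟶ B ⟶ Z`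
with `B` in `𝒳`. Embedding `B` into `W` in `𝒲` and taking the octahedron gives `W' ⟶ W ⟶ M`, a
resolution of `M`, together with `Z ⟶ M ⟶ X''`. -/
lemma approximations (n : ℕ) {Z : C} (hZ : T.resDimLE 𝒳 n Z) :
    ∃ M X, T.HasConflation Z M X ∧ T.resDimLE 𝒲 n M ∧ 𝒳 X := by
  induction n generalizing Z with
  | zero => exact h.exists_cogenerator hZ
  | succ n ih =>
    obtain ⟨K, X₀, hc, hX₀, hK⟩ := resDimLE_succ_iff.1 hZ
    obtain ⟨W', X', hc', hW', hX'⟩ := ih hK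
    obtain ⟨B, hB, hB'⟩ := hc.pushout hc'
    obtain ⟨W, X'', hc'', hW, hX''⟩ := h.exists_cogenerator (prop_of_extensions h.extensions hB hX₀ hX')
    obtain ⟨M, hM, hM'⟩ := hB'.octahedron hc''
    exact ⟨M, X'', hM', resDimLE_succ_iff.2 ⟨_, _, hM, hW, hW'⟩, hX''⟩

lemma left_approximation (n : ℕ) {Z : C} (hZ : T.resDimLE 𝒳 (n + 1) Z) :
    ∃ V X, T.HasConflation V X Z ∧ T.resDimLE 𝒲 n V ∧ 𝒳 X := by
  obtain ⟨K, X₀, hc, hX₀, hK⟩ := resDimLE_succ_iff.1 hZ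
  obtain ⟨W', X', hc', hW', hX'⟩ := h.approximations n hK
  obtain ⟨B, hB, hB'⟩ := hc.pushout hc'
  exact ⟨W', B, hB', hW', prop_of_extensions h.extensions hB hX₀ hX'⟩

lemma exists_left_approximation {Z : C} (hZ : T.hat 𝒳 Z) :
    ∃ V X, T.HasConflation V X Z ∧ T.hat 𝒲 V ∧ 𝒳 X := by
  obtain ⟨n, hZ⟩ := hZ
  -- The dimension bound is raised by one so that dimension zero is covered too.
  obtain ⟨V, X, hc, hV, hX⟩ := h.left_approximation n (resDimLE_succ h.isSubcategory_left n _ hZ)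
  exact ⟨V, X, hc, ⟨n, hV⟩, hX⟩

lemma exists_right_approximation {Z : C} (hZ : T.hat 𝒳 Z) :
    ∃ V X, T.HasConflation Z V X ∧ T.hat 𝒲 V ∧ 𝒳 X := by
  obtain ⟨n, hZ⟩ := hZ
  obtain ⟨V, X, hc, hV, hX⟩ := h.approximations n hZ
  exact ⟨V, X, hc, ⟨n, hV⟩, hX⟩

/-- A horseshoe argument: the pullback of `B` along `W ⟶ X` splits as `A ⊞ W`, so `W' ⊞ W` maps onto
`B` by a composite of deflations, with cocone an extension of `K` by `K' ⊞ 0`. -/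
lemma resDimLE_extension (n : ℕ) {A B X : C} (hc : T.HasConflation A B X)
    (hA : T.resDimLE 𝒲 n A) (hX : T.resDimLE 𝒲 n X) : T.resDimLE 𝒲 n B := by
  induction n generalizing A B X with
  | zero =>
    obtain ⟨i⟩ := hc.split (h.vanishes_hat (h.cogenerator.1 _ hX) (hat_of_prop _ hA))
    exact h.isSubcategory_right.iso i.symm (h.isSubcategory_right.sum hA hX)
  | succ n ih =>
    obtain ⟨K, W, hcX, hW, hK⟩ := resDimLE_succ_iff.1 hX
    obtain ⟨K', W', hcA, hW', hK'⟩ := resDimLE_succ_iff.1 hA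
    obtain ⟨P, hP₁, hP₂⟩ := hc.pullback hcX
    obtain ⟨i⟩ := hP₁.split (h.vanishes_hat (h.cogenerator.1 _ hW) ⟨n + 1, hA⟩)
    have hs := hcA.sum (hasConflation_id (T := T) (isZero_zero C) W)
    obtain ⟨M, hM, hM'⟩ := (hs.of_iso (Iso.refl _) (Iso.refl _) i.symm).octahedron_op hP₂
    refine resDimLE_succ_iff.2 ⟨M, _, hM, h.isSubcategory_right.sum hW' hW, ih hM' ?_ hK⟩
    exact resDimLE_sum h.isSubcategory_right hK'
      (resDimLE_le h.isSubcategory_right n.zero_le _ (h.isSubcategory_right.zero (isZero_zero C)))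

lemma hat_right_extensions : T.ClosedUnderExtensions (T.hat 𝒲) := by
  rintro A B X x y hc ⟨n, hA⟩ ⟨m, hX⟩
  exact ⟨max n m, h.resDimLE_extension _ ⟨x, y, hc⟩
    (resDimLE_le h.isSubcategory_right (le_max_left _ _) _ hA)
    (resDimLE_le h.isSubcategory_right (le_max_right _ _) _ hX)⟩

lemma resDimLE_cocone (n : ℕ) {A B X : C} (hc : T.HasConflation A B X)
    (hB : T.resDimLE 𝒳 n B) (hX : 𝒳 X) : T.resDimLE 𝒳 n A := by
  cases n with
  | zero => exact prop_of_cocones h.cocones hc hB hX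
  | succ n =>
    obtain ⟨K, X₀, hc', hX₀, hK⟩ := resDimLE_succ_iff.1 hB
    obtain ⟨M, hM, hM'⟩ := hc'.octahedron_op hc
    exact resDimLE_succ_iff.2 ⟨K, M, hM', prop_of_cocones h.cocones hM hX₀ hX, hK⟩

lemma hat_le_hat : T.hat 𝒲 ≤ T.hat 𝒳 := hat_mono h.cogenerator.1

lemma hat_cocone {A B X : C} (hc : T.HasConflation A B X)
    (hB : T.hat 𝒳 B) (hX : 𝒳 X) : T.hat 𝒳 A := by
  obtain ⟨n, hB⟩ := hB
  exact ⟨n, h.resDimLE_cocone n hc hB hX⟩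

/-- The pushout along `A ⟶ V` with `V` in `hat 𝒲` splits as `V ⊞ X`, and `B` is the cocone of a
deflation from it onto an object of `𝒳`. -/
lemma hat_extension_of_prop {A B X : C} (hc : T.HasConflation A B X)
    (hA : T.hat 𝒳 A) (hX : 𝒳 X) : T.hat 𝒳 B := by
  obtain ⟨V, X', hc', hV, hX'⟩ := h.exists_right_approximation hA
  obtain ⟨N, hN, hN'⟩ := hc.pushout hc'
  obtain ⟨i⟩ := hN'.split (h.vanishes_hat hX hV)
  refine h.hat_cocone hN (hat_iso h.isSubcategory_left i.symm ?_) hX'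
  exact hat_sum h.isSubcategory_left (h.hat_le_hat _ hV) (hat_of_prop _ hX)

/-- Pulling back to `X₀` in `𝒳` reduces to `hat_extension_of_prop`. The resulting `M` deflates onto
`B` with cocone `V`; an approximation `X₁` of `M` then deflates onto `B` with cocone `L`, an
extension of `V` by `V'`, hence in `hat 𝒲`. -/
lemma hat_extensions : T.ClosedUnderExtensions (T.hat 𝒳) := by
  intro A B X x y hc hA hX
  obtain ⟨V, X₀, hc', hV, hX₀⟩ := h.exists_left_approximation hX
  obtain ⟨M, hM, hM'⟩ := HasConflation.pullback ⟨x, y, hc⟩ hc'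
  obtain ⟨V', X₁, hc₁, hV', hX₁⟩ := h.exists_left_approximation (h.hat_extension_of_prop hM hA hX₀)
  obtain ⟨L, hL, hL'⟩ := hc₁.octahedron_op hM'
  exact hat_of_hasConflation hL hX₁ (h.hat_le_hat _ (prop_of_extensions h.hat_right_extensions hL' hV' hV))

lemma hat_cocones : T.ClosedUnderCocones (T.hat 𝒳) := by
  intro A B X x y hc hB hX
  obtain ⟨V, X₀, hc', hV, hX₀⟩ := h.exists_left_approximation hX
  obtain ⟨M, hM, hM'⟩ := HasConflation.pullback ⟨x, y, hc⟩ hc'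
  exact h.hat_cocone hM (prop_of_extensions h.hat_extensions hM' (h.hat_le_hat _ hV) hB) hX₀

/-- A Schanuel-type argument. One approximation `X₀` of `A ⊞ B`, composed with the two projections,
has cocones `K₁` and `K₂`. Comparing it with the sum of these conflations bounds the dimension of
`K₁ ⊞ K₂` by `n`, so induction applies to `K₁`. -/
lemma resDimLE_summand (n : ℕ) {A B : C} (hAB : T.resDimLE 𝒳 n (A ⊞ B)) :
    T.resDimLE 𝒳 n A := by
  induction n generalizing A B with
  | zero => exact h.isSubcategory_left.summand hAB
  | succ n ih =>
    obtain ⟨K, X₀, hc, hK, hX₀⟩ := h.left_approximation n hAB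
    obtain ⟨K₁, hK₁, -⟩ := hc.octahedron_op (hasConflation_biprod' A B)
    obtain ⟨K₂, hK₂, -⟩ := hc.octahedron_op (hasConflation_biprod A B)
    obtain ⟨M, hM, hM'⟩ := hc.pullback (hK₁.sum hK₂)
    have hXX := h.isSubcategory_left.sum hX₀ hX₀
    obtain ⟨i⟩ := hM.split (h.vanishes_hat hXX ⟨n, hK⟩)
    refine resDimLE_succ_iff.2 ⟨K₁, X₀, hK₁, hX₀, ih (h.resDimLE_cocone n hM' ?_ hX₀)⟩
    exact resDimLE_iso h.isSubcategory_left i.symm (resDimLE_sum h.isSubcategory_left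
      (resDimLE_mono h.cogenerator.1 n _ hK) (resDimLE_le h.isSubcategory_left n.zero_le _ hXX))

lemma hat_isThick : T.IsThick (T.hat 𝒳) where
  isSubcategory :=
    { iso := hat_iso h.isSubcategory_left
      zero := fun hA => hat_of_prop _ (h.isSubcategory_left.zero hA)
      sum := hat_sum h.isSubcategory_left
      summand := fun ⟨n, hn⟩ => ⟨n, h.resDimLE_summand n hn⟩ }
  extensions := h.hat_extensions
  cocones := h.hat_cocones
  cones := hat_cones h.isSubcategory_left h.hat_extensions

lemma thick_eq_hat : T.thick 𝒳 = T.hat 𝒳 :=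
  le_antisymm (fun _ hA => hA _ h.hat_isThick hat_of_prop) (hat_le_thick 𝒳)

/-- The cogenerator conflation starting at `Z` splits, making `Z` a summand of an object of `𝒲`. -/
lemma right_of_vanishes {Z : C} (hZ : 𝒳 Z) (hv : ∀ X, 𝒳 X → T.Vanishes X Z) : 𝒲 Z := by
  obtain ⟨W, X', hc, hW, hX'⟩ := h.exists_cogenerator hZ
  obtain ⟨i⟩ := hc.split (hv _ hX')
  exact h.isSubcategory_right.summand (h.isSubcategory_right.iso i hW)

/-- This intrinsic description yields closure under summands and the identification with `𝒱` in the
main theorem. For the converse, the middle term of a left approximation inherits the vanishing,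
hence lies in `𝒲`. -/
lemma hat_right_iff (Z : C) :
    T.hat 𝒲 Z ↔ T.hat 𝒳 Z ∧ ∀ X, 𝒳 X → T.Vanishes X Z := by
  refine ⟨fun hZ => ⟨h.hat_le_hat _ hZ, fun X hX => h.vanishes_hat hX hZ⟩, ?_⟩
  rintro ⟨hZ, hv⟩
  obtain ⟨V, X₀, hc, hV, hX₀⟩ := h.exists_left_approximation hZ
  refine hat_of_hasConflation hc (h.right_of_vanishes hX₀ fun X hX => ?_) hV
  exact Vanishes.mid_right hc (h.vanishes_hat hX hV) (hv X hX)

lemma isSubcategory_hat_right : IsSubcategory (T.hat 𝒲) where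
  iso := hat_iso h.isSubcategory_right
  zero := fun hA => hat_of_prop _ (h.isSubcategory_right.zero hA)
  sum := hat_sum h.isSubcategory_right
  summand := fun {A B} hAB => by
    rw [h.hat_right_iff] at hAB ⊢
    exact ⟨h.hat_isThick.isSubcategory.summand hAB.1, fun X hX =>
      (hAB.2 X hX).of_retract_right biprod.inl biprod.fst (by simp)⟩

lemma inf_hat : 𝒳 ⊓ T.hat 𝒲 = 𝒲 := by
  refine le_antisymm ?_ (le_inf h.cogenerator.1 hat_of_prop)
  rintro Z ⟨hZ, hZ'⟩
  exact h.right_of_vanishes hZ fun X hX => h.vanishes_hat hX hZ'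

lemma isCotorsionPairOn : T.IsCotorsionPairOn (T.thick 𝒳) 𝒳 (T.hat 𝒲) where
  left_le := le_thick 𝒳
  right_le := h.hat_le_hat.trans (hat_le_thick 𝒳)
  isSubcategory_left := h.isSubcategory_left
  isSubcategory_right := h.isSubcategory_hat_right
  ext_eq_zero := fun _ _ hU hV => h.vanishes_hat hU hV
  left_approx := fun Z hZ => by
    rw [h.thick_eq_hat] at hZ
    obtain ⟨V, X, ⟨x, y, hc⟩, hV, hX⟩ := h.exists_left_approximation hZ
    exact ⟨V, X, x, y, hc, hX, hV⟩
  right_approx := fun Z hZ => by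
    rw [h.thick_eq_hat] at hZ
    obtain ⟨V, X, ⟨x, y, hc⟩, hV, hX⟩ := h.exists_right_approximation hZ
    exact ⟨V, X, x, y, hc, hX, hV⟩

end IsLeftFrobeniusPair

/-! ### From cotorsion pairs back to left Frobenius pairs. -/

namespace IsCotorsionPairOn

variable {𝒯 𝒰 𝒱 : ObjectProperty C} (h : T.IsCotorsionPairOn 𝒯 𝒰 𝒱)
include h

/-- An orthogonal object splits off its own approximation. -/
lemma left_iff (Z : C) : 𝒰 Z ↔ 𝒯 Z ∧ ∀ V, 𝒱 V → T.Vanishes Z V := by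
  refine ⟨fun hZ => ⟨h.left_le _ hZ, fun V hV => h.ext_eq_zero Z V hZ hV⟩, ?_⟩
  rintro ⟨hZ, hv⟩
  obtain ⟨V, U, x, y, hc, hU, hV⟩ := h.left_approx Z hZ
  obtain ⟨i⟩ := HasConflation.split ⟨x, y, hc⟩ (hv V hV)
  exact h.isSubcategory_left.summand
    (h.isSubcategory_left.iso (i ≪≫ biprod.braiding V Z) hU)

lemma right_iff (Z : C) : 𝒱 Z ↔ 𝒯 Z ∧ ∀ U, 𝒰 U → T.Vanishes U Z := by
  refine ⟨fun hZ => ⟨h.right_le _ hZ, fun U hU => h.ext_eq_zero U Z hU hZ⟩, ?_⟩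
  rintro ⟨hZ, hv⟩
  obtain ⟨V, U, x, y, hc, hU, hV⟩ := h.right_approx Z hZ
  obtain ⟨i⟩ := HasConflation.split ⟨x, y, hc⟩ (hv U hU)
  exact h.isSubcategory_right.summand (h.isSubcategory_right.iso i hV)

end IsCotorsionPairOn

lemma IsCotorsionPairOn.isLeftFrobeniusPair {𝒯 𝒰 𝒱 : ObjectProperty C}
    (h : T.IsCotorsionPairOn 𝒯 𝒰 𝒱) (h𝒯 : T.IsThick 𝒯) (hp : 𝒱 ≤ perp hP 𝒰) :
    IsLeftFrobeniusPair hP 𝒰 (𝒰 ⊓ 𝒱) := by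
  have hE : T.ClosedUnderExtensions 𝒰 := by
    intro A B X x y hc hA hX
    refine (h.left_iff B).2 ⟨h𝒯.extensions x y hc (h.left_le _ hA) (h.left_le _ hX), ?_⟩
    exact fun V hV => Vanishes.mid_left ⟨x, y, hc⟩ (h.ext_eq_zero _ _ hA hV)
      (h.ext_eq_zero _ _ hX hV)
  refine ⟨h.isSubcategory_left, ?_, hE, ?_, ⟨inf_le_left, ?_⟩, inf_le_right.trans hp⟩
  · exact
      { iso := fun i hA => ⟨h.isSubcategory_left.iso i hA.1, h.isSubcategory_right.iso i hA.2⟩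
        zero := fun hA => ⟨h.isSubcategory_left.zero hA, h.isSubcategory_right.zero hA⟩
        sum := fun hA hB =>
          ⟨h.isSubcategory_left.sum hA.1 hB.1, h.isSubcategory_right.sum hA.2 hB.2⟩
        summand := fun hA =>
          ⟨h.isSubcategory_left.summand hA.1, h.isSubcategory_right.summand hA.2⟩ }
  · intro A B X x y hc hB hX
    refine (h.left_iff A).2 ⟨h𝒯.cocones x y hc (h.left_le _ hB) (h.left_le _ hX), ?_⟩
    intro V hV
    obtain ⟨P, hS, hPr⟩ := syzygy_hasConflation hP X
    -- Index `1` in `perp` is `𝔼²(X, V) = 0`, which orthogonality of the pair alone does not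
    -- provide.
    exact Vanishes.of_syzygy_left ⟨x, y, hc⟩ hS hPr (h.ext_eq_zero _ _ hB hV)
      (hp V hV 1 X hX)
  · intro X hX
    obtain ⟨V, U, x, y, hc, hU, hV⟩ := h.right_approx X (h.left_le _ hX)
    -- The middle term lies in `𝒰` as an extension of `U` by `X`.
    exact ⟨V, U, x, y, hc, ⟨hE x y hc hX hU, hV⟩, hU⟩

end Frobenius

end Extriangulated

end Extri

theorem theorem3p11 {C : Type*} [Category* C] [Preadditive C] [HasZeroObject C]
    [HasBinaryBiproducts C]
    (T : Extri.Extriangulated C) (hP : T.EnoughProjectives) (hI : T.EnoughInjectives) :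
    let F : ObjectProperty C × ObjectProperty C → ObjectProperty C × ObjectProperty C :=
      fun p => (p.1, T.hat p.2)
    let G : ObjectProperty C × ObjectProperty C → ObjectProperty C × ObjectProperty C :=
      fun p => (p.1, p.1 ⊓ p.2)
    Set.BijOn F (Extri.Extriangulated.leftFrobeniusPairs hP)
        (Extri.Extriangulated.thickCotorsionPairs hP) ∧
      Set.BijOn G (Extri.Extriangulated.thickCotorsionPairs hP)
        (Extri.Extriangulated.leftFrobeniusPairs hP) ∧
      Set.InvOn G F (Extri.Extriangulated.leftFrobeniusPairs hP)
        (Extri.Extriangulated.thickCotorsionPairs hP) := by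
  intro F G
  have hF : Set.MapsTo F (Extri.Extriangulated.leftFrobeniusPairs hP)
      (Extri.Extriangulated.thickCotorsionPairs hP) := fun p hp =>
    ⟨hp.isCotorsionPairOn, Extri.Extriangulated.perp_hat hp.relInjective⟩
  have hG : Set.MapsTo G (Extri.Extriangulated.thickCotorsionPairs hP)
      (Extri.Extriangulated.leftFrobeniusPairs hP) := fun p hp =>
    hp.1.isLeftFrobeniusPair (Extri.Extriangulated.thick_isThick p.1) hp.2
  have hFG : Set.InvOn G F (Extri.Extriangulated.leftFrobeniusPairs hP)
      (Extri.Extriangulated.thickCotorsionPairs hP) := by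
    refine ⟨fun p hp => Prod.ext rfl hp.inf_hat, fun p hp => Prod.ext rfl ?_⟩
    have hL : Extri.Extriangulated.IsLeftFrobeniusPair hP p.1 (p.1 ⊓ p.2) := hG hp
    ext Z
    change T.hat (p.1 ⊓ p.2) Z ↔ p.2 Z
    -- Both classes are the right orthogonal of `p.1` inside `thick p.1`.
    rw [hL.hat_right_iff, hp.1.right_iff, hL.thick_eq_hat]
  exact ⟨hFG.bijOn hF hG, hFG.symm.bijOn hG hF, hFG⟩
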